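/- Let $S$ be a finite set of states and let $\Delta$ assign to every $s\in S$ a probability distribution $\Delta(s)$ on $S$ (a finite Markov chain). Let $\nu:S\to 2^{AP}$ be a valuation, where $AP$ is a set of atomic propositions. For $s\in S$ let $\mathbb P_s$ and $\mathbb E_s$ be the probability measure and the expectation on runs $\omega=s_0s_1\cdots$ of the chain started in $s$, with the $\sigma$-algebra generated by cylinders, and let $\omega(i)=s_is_{i+1}\cdots$. For a sequence $x_0,x_1,\ldots$ of numbers put $\mathrm{freq}(x_0x_1\ldots)=\liminf_{n\to\infty}\frac1n\sum_{j<n}x_j$. LTL formulae are given by $\varphi::=\alpha\mid\neg\varphi\mid\varphi\vee\varphi\mid\mathbf X\varphi\mid\varphi\,\mathbf U\,\varphi$ with $\alpha\in AP$. Their semantics on runs is the usual one: $\omega\models\alpha$ iff $\alpha\in\nu(s_0)$; negation and disjunction are Boolean; $\omega\models\mathbf X\varphi$ iff $\omega(1)\models\varphi$; $\omega\models\varphi_1\mathbf U\varphi_2$ iff there is $k\ge 0$ with $\omega(k)\models\varphi_2$ and $\omega(\ell)\models\varphi_1$ for all $\ell<k$. For a real number $p$ put $\omega\models\mathbf G^p\varphi$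 iff $\mathrm{freq}(\mathbf 1_{\varphi,0}\mathbf 1_{\varphi,1}\ldots)\ge p$, where $\mathbf 1_{\varphi,i}$ is $1$ if $\omega(i)\models\varphi$ and $0$ otherwise. A bottom strongly connected component (bscc) is a non-empty set $B\subseteq S$ such that for every $s\in B$ the set of states reachable from $s$ is exactly $B$. The steady-state frequency of a state $t$ in a bscc is $x_t=\mathbb E_t[\mathrm{freq}(\mathbf 1_{t,0}\mathbf 1_{t,1}\ldots)]$, where $\mathbf 1_{t,i}(\omega)$ is $1$ if the $i$-th state of $\omega$ is $t$ and $0$ otherwise. Write $\mathbb P_t(\varphi)=\mathbb P_t(\{\omega\mid\omega\models\varphi\})$. Then for every initial state $s_{in}\in S$, every LTL formula $\varphi$, every real number $p$ and every bscc $B$, for $\mathbb P_{s_{in}}$-almost every run $\omega$: if $\omega$ enters $B$, then $$\omega\models\mathbf G^p\varphi\quad\Longleftrightarrow\quad\sum_{t\in B}x_t\cdot\mathbb P_t(\varphi)\ge p .$$ -/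

import Mathlib

namespace FreqLTL

/-- Syntax of frequency LTL over a set `AP` of atomic propositions. -/
inductive Formula (AP : Type*) : Type _
  | atom (a : AP) : Formula AP
  | neg (φ : Formula AP) : Formula AP
  | or (φ ψ : Formula AP) : Formula AP
  | next (φ : Formula AP) : Formula AP
  | untl (φ ψ : Formula AP) : Formula AP
  | freqG (p : ℝ) (φ : Formula AP) : Formula AP

/-- LTL formulae: the frequency LTL formulae in which no frequency operator occurs. -/
def Formula.IsLTL {AP : Type*} : Formula AP → Prop
  | .atom _ => True
  | .neg φ => φ.IsLTL
  | .or φ ψ => φ.IsLTL ∧ ψ.IsLTL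
  | .next φ => φ.IsLTL
  | .untl φ ψ => φ.IsLTL ∧ ψ.IsLTL
  | .freqG _ _ => False

/-- The limit inferior of the running averages of a sequence. It is only applied to sequences
with values in `{0, 1}`, whose running averages are bounded. -/
noncomputable def freq (x : ℕ → ℝ) : ℝ :=
  Filter.liminf (fun n : ℕ => (1 / (n : ℝ)) * ∑ j ∈ Finset.range n, x j) Filter.atTop

/-- The suffix of `ω` starting at position `i`. -/
def suffix {S : Type*} (ω : ℕ → S) (i : ℕ) : ℕ → S := fun n => ω (i + n)

/-- Satisfaction of a formula on a sequence of states, for a valuation `ν`. -/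
def Sat {S AP : Type*} (ν : S → Set AP) : Formula AP → (ℕ → S) → Prop
  | .atom a, ω => a ∈ ν (ω 0)
  | .neg φ, ω => ¬ Sat ν φ ω
  | .or φ ψ, ω => Sat ν φ ω ∨ Sat ν ψ ω
  | .next φ, ω => Sat ν φ (suffix ω 1)
  | .untl φ ψ, ω => ∃ k, Sat ν ψ (suffix ω k) ∧ ∀ l < k, Sat ν φ (suffix ω l)
  | .freqG p φ, ω => p ≤ freq (Set.indicator {i : ℕ | Sat ν φ (suffix ω i)} 1)

section MarkovChain

variable {S : Type*} [MeasurableSpace S] [DiscreteMeasurableSpace S]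

/-- The one-step kernel of the Markov chain with transition function `Δ`. -/
noncomputable def stepKernel (Δ : S → PMF S) : ProbabilityTheory.Kernel S S where
  toFun s := (Δ s).toMeasure
  measurable' := Measurable.of_discrete

instance isMarkovKernel_stepKernel (Δ : S → PMF S) : ProbabilityTheory.IsMarkovKernel (stepKernel Δ) :=
  ⟨fun s => PMF.toMeasure.isProbabilityMeasure (Δ s)⟩

/-- The law of the runs of the Markov chain `Δ` started in `s`, on the space `ℕ → S` with the
σ-algebra generated by cylinders: the state at time `0` is `s`, and given a history of length
`n + 1` the next state is distributed as `Δ` of its last state. -/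
noncomputable def runMeasure (Δ : S → PMF S) (s : S) : MeasureTheory.Measure (ℕ → S) :=
  ProbabilityTheory.Kernel.trajMeasure (X := fun _ => S) (MeasureTheory.Measure.dirac s)
    (fun n => (stepKernel Δ).comap
      (fun h : (i : Finset.Iic n) → S => h ⟨n, Finset.mem_Iic.2 le_rfl⟩)
      (measurable_pi_apply _))

/-- The probability that a run started in `s` satisfies `φ`. -/
noncomputable def satProb {AP : Type*} (Δ : S → PMF S) (ν : S → Set AP) (s : S)
    (φ : Formula AP) : ℝ :=
  (runMeasure Δ s).real {ω | Sat ν φ ω}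

/-- The steady-state frequency of `s`: the expected frequency of visits to `s` on a run started
in `s`. -/
noncomputable def steadyFreq (Δ : S → PMF S) (s : S) : ℝ :=
  ∫ ω, freq (Set.indicator {i : ℕ | ω i = s} 1) ∂(runMeasure Δ s)

end MarkovChain

/-- `t` is reachable from `s` by a finite path with positive transition probabilities. -/
def Reachable {S : Type*} (Δ : S → PMF S) : S → S → Prop :=
  Relation.ReflTransGen (fun s t => 0 < Δ s t)

/-- `B` is a bottom strongly connected component: from each of its states, the set of reachable
states is exactly `B`. -/
def IsBSCC {S : Type*} (Δ : S → PMF S) (B : Finset S) : Prop :=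
  B.Nonempty ∧ ∀ s ∈ B, {t | Reachable Δ s t} = (B : Set S)

end FreqLTL

open MeasureTheory ProbabilityTheory Filter Topology
open scoped ENNReal

/-!
On a bottom component `B` the chain has a stationary distribution `μ`, and the law of the runs with
initial distribution `μ` is invariant under the shift. The probability of a shift-invariant event is
a harmonic function of the initial state, hence constant on `B` by the maximum principle. By the
Markov property such an event is then independent of every finite history, so of itself, and the
shift is ergodic. By Birkhoff's theorem an event `A` recurs along almost every run started in `B`
with frequency `∑ t ∈ B, μ {t} * ℙ_t(A)`, and a finite prefix spent outside `B` does not change the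
frequency. Taking `A` to be the event that the run starts in `t` identifies `μ {t}` as the
steady-state frequency of `t`.
-/

namespace FreqLTL

section ErgodicTheorem

variable {α : Type*} {T : α → α} {f : α → ℝ}

lemma partialSups_birkhoffSum_succ (T : α → α) (f : α → ℝ) (n : ℕ) (x : α) :
    partialSups (birkhoffSum T f) (n + 1) x =
      max 0 (f x + partialSups (birkhoffSum T f) n (T x)) := by
  induction n with
  | zero =>
    rw [partialSups_add_one]
    simp
  | succ n ih =>
    rw [partialSups_add_one, Pi.sup_apply, ih, partialSups_add_one _ n, Pi.sup_apply,
      birkhoffSum_succ', sup_assoc, max_add_add_left]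

lemma partialSups_birkhoffSum_sub_le_indicator (T : α → α) (f : α → ℝ) (n : ℕ) (x : α) :
    partialSups (birkhoffSum T f) n x - partialSups (birkhoffSum T f) n (T x) ≤
      Set.indicator {y | 0 < partialSups (birkhoffSum T f) n y} f x := by
  have nonneg (y : α) : 0 ≤ partialSups (birkhoffSum T f) n y := by
    simpa using le_partialSups_of_le (birkhoffSum T f) (Nat.zero_le n) y
  by_cases hx : 0 < partialSups (birkhoffSum T f) n x
  · have hsucc : partialSups (birkhoffSum T f) n x ≤ partialSups (birkhoffSum T f) (n + 1) x :=
      (partialSups (birkhoffSum T f)).monotone n.le_succ x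
    have hmax := partialSups_birkhoffSum_succ T f n x
    rw [max_eq_right_of_lt ((lt_max_iff.1 (hmax ▸ hx.trans_le hsucc)).resolve_left (lt_irrefl 0))]
      at hmax
    rw [Set.indicator_of_mem (by exact hx)]
    linarith
  · rw [Set.indicator_of_notMem (by exact hx)]
    linarith [nonneg (T x)]

lemma bddAbove_range_birkhoffSum_apply_iff (x : α) :
    BddAbove (Set.range (birkhoffSum T f · (T x))) ↔
      BddAbove (Set.range (birkhoffSum T f · x)) := by
  constructor
  · rintro ⟨C, hC⟩
    refine ⟨max 0 (f x + C), Set.forall_mem_range.2 fun n => ?_⟩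
    cases n with
    | zero => simp
    | succ n =>
      rw [birkhoffSum_succ']
      exact le_max_of_le_right (add_le_add_right (hC ⟨n, rfl⟩) _)
  · rintro ⟨C, hC⟩
    refine ⟨C - f x, Set.forall_mem_range.2 fun n => ?_⟩
    have := hC ⟨n + 1, rfl⟩
    dsimp only at this ⊢
    rw [birkhoffSum_succ'] at this
    linarith

lemma tendsto_birkhoffAverage_apply_iff {c : ℝ} (x : α) :
    Tendsto (birkhoffAverage ℝ T f · (T x)) atTop (𝓝 c) ↔
      Tendsto (birkhoffAverage ℝ T f · x) atTop (𝓝 c) := by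
  have hone : Tendsto (fun n : ℕ => (n : ℝ) / (n + 1 : ℕ)) atTop (𝓝 1) := by
    simpa using tendsto_natCast_div_add_atTop (1 : ℝ)
  have hzero : Tendsto (fun n : ℕ => f x / (n + 1 : ℕ)) atTop (𝓝 0) :=
    (tendsto_const_div_atTop_nhds_zero_nat (f x)).comp (tendsto_add_atTop_nat 1)
  have hsucc (n : ℕ) : birkhoffAverage ℝ T f (n + 1) x =
      f x / (n + 1 : ℕ) + (n : ℝ) / (n + 1 : ℕ) * birkhoffAverage ℝ T f n (T x) := by
    rcases eq_or_ne n 0 with rfl | hn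
    · simp
    · simp only [birkhoffAverage, birkhoffSum_succ', smul_eq_mul]
      field_simp
  rw [← tendsto_add_atTop_iff_nat (f := (birkhoffAverage ℝ T f · x)) 1]
  constructor
  · intro h
    simpa [hsucc] using hzero.add (hone.mul h)
  · intro h
    have hquot := (h.sub hzero).div hone one_ne_zero
    rw [sub_zero, div_one] at hquot
    refine hquot.congr' ?_
    filter_upwards [eventually_ne_atTop 0] with n hn
    have : (n : ℝ) / (n + 1 : ℕ) ≠ 0 := by positivity
    simp only [Pi.div_apply, hsucc, add_sub_cancel_left]
    exact mul_div_cancel_left₀ _ this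

variable [MeasurableSpace α] {μ : Measure α}

lemma integrable_birkhoffSum (hT : MeasurePreserving T μ μ) (hf : Integrable f μ) (n : ℕ) :
    Integrable (birkhoffSum T f n) μ :=
  integrable_finsetSum _ fun k _ => (hT.iterate k).integrable_comp_of_integrable hf

lemma integrable_partialSups_birkhoffSum (hT : MeasurePreserving T μ μ) (hf : Integrable f μ)
    (n : ℕ) : Integrable (partialSups (birkhoffSum T f) n) μ := by
  induction n with
  | zero => simp
  | succ n ih =>
    rw [partialSups_add_one]
    exact ih.sup (integrable_birkhoffSum hT hf (n + 1))

lemma nullMeasurableSet_partialSups_birkhoffSum_pos (hT : MeasurePreserving T μ μ)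
    (hf : Integrable f μ) (n : ℕ) :
    NullMeasurableSet {x | 0 < partialSups (birkhoffSum T f) n x} μ :=
  nullMeasurableSet_lt aemeasurable_const (integrable_partialSups_birkhoffSum hT hf n).aemeasurable

lemma integral_indicator_partialSups_birkhoffSum_nonneg (hT : MeasurePreserving T μ μ)
    (hf : Integrable f μ) (n : ℕ) :
    0 ≤ ∫ x, Set.indicator {y | 0 < partialSups (birkhoffSum T f) n y} f x ∂μ := by
  have hi := integrable_partialSups_birkhoffSum hT hf n
  have hiT : Integrable (fun x => partialSups (birkhoffSum T f) n (T x)) μ :=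
    hT.integrable_comp_of_integrable hi
  have hcomp : ∫ x, partialSups (birkhoffSum T f) n (T x) ∂μ =
      ∫ x, partialSups (birkhoffSum T f) n x ∂μ := by
    rw [← integral_map hT.aemeasurable (hT.map_eq.symm ▸ hi.aestronglyMeasurable), hT.map_eq]
  calc 0 = ∫ x, (partialSups (birkhoffSum T f) n x - partialSups (birkhoffSum T f) n (T x)) ∂μ := by
        rw [integral_sub hi hiT, hcomp, sub_self]
    _ ≤ _ := integral_mono (hi.sub hiT)
        (hf.indicator₀ (nullMeasurableSet_partialSups_birkhoffSum_pos hT hf n))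
        (partialSups_birkhoffSum_sub_le_indicator T f n)

/-- The maximal ergodic theorem. -/
theorem integral_nonneg_of_ae_exists_birkhoffSum_pos (hT : MeasurePreserving T μ μ)
    (hf : Integrable f μ) (h : ∀ᵐ x ∂μ, ∃ n, 0 < birkhoffSum T f n x) : 0 ≤ ∫ x, f x ∂μ := by
  refine ge_of_tendsto' (tendsto_integral_of_dominated_convergence (fun x => ‖f x‖)
    (fun n => (hf.indicator₀
      (nullMeasurableSet_partialSups_birkhoffSum_pos hT hf n)).aestronglyMeasurable) hf.norm
    (fun n => ae_of_all _ (norm_indicator_le_norm_self f)) ?_)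
    (integral_indicator_partialSups_birkhoffSum_nonneg hT hf)
  filter_upwards [h] with x ⟨n, hn⟩
  refine tendsto_const_nhds.congr' ?_
  filter_upwards [eventually_ge_atTop n] with N hnN
  rw [Set.indicator_of_mem]
  exact hn.trans_le (le_partialSups_of_le (birkhoffSum T f) hnN x)

/-- Boundedness of the Birkhoff sums is an exactly invariant event, which makes this the convenient
form in which to combine ergodicity with the maximal ergodic theorem. -/
lemma ae_bddAbove_range_birkhoffSum_of_integral_neg (hT : Ergodic T μ) (hf : Integrable f μ)
    (hneg : ∫ x, f x ∂μ < 0) : ∀ᵐ x ∂μ, BddAbove (Set.range (birkhoffSum T f · x)) := by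
  obtain ⟨g, hg, hfg⟩ := hf.aemeasurable
  have hmeas : NullMeasurableSet {x | BddAbove (Set.range (birkhoffSum T f · x))} μ := by
    have hgsum (n : ℕ) : Measurable (birkhoffSum T g n) :=
      Finset.measurable_fun_sum _ fun k _ => hg.comp (hT.measurable.iterate k)
    refine (measurableSet_bddAbove_range hgsum).nullMeasurableSet.congr ?_
    filter_upwards [ae_all_iff.2 fun n =>
      hT.quasiMeasurePreserving.birkhoffSum_ae_eq_of_ae_eq hfg n] with x hx
    change BddAbove _ = BddAbove _
    simp only [hx]
  have hinv : T ⁻¹' {x | BddAbove (Set.range (birkhoffSum T f · x))} =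
      {x | BddAbove (Set.range (birkhoffSum T f · x))} :=
    Set.ext bddAbove_range_birkhoffSum_apply_iff
  refine (hT.quasiErgodic.ae_mem_or_ae_notMem₀ hmeas hinv.eventuallyEq).resolve_right fun hunbdd =>
    hneg.not_ge (integral_nonneg_of_ae_exists_birkhoffSum_pos hT.toMeasurePreserving hf ?_)
  filter_upwards [hunbdd] with x hx
  obtain ⟨_, ⟨n, rfl⟩, hn⟩ := not_bddAbove_iff.1 hx 0
  exact ⟨n, hn⟩

variable [IsProbabilityMeasure μ]

lemma ae_eventually_birkhoffAverage_lt (hT : Ergodic T μ) (hf : Integrable f μ) {a : ℝ}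
    (ha : ∫ x, f x ∂μ < a) : ∀ᵐ x ∂μ, ∀ᶠ n in atTop, birkhoffAverage ℝ T f n x < a := by
  obtain ⟨b, hfb, hba⟩ := exists_between ha
  have hneg : ∫ x, (f x - b) ∂μ < 0 := by
    rw [integral_sub hf (integrable_const b)]
    simpa using hfb
  filter_upwards [ae_bddAbove_range_birkhoffSum_of_integral_neg hT (hf.sub (integrable_const b))
    hneg] with x ⟨C, hC⟩
  have hlim : Tendsto (fun n : ℕ => b + C / n) atTop (𝓝 b) := by
    simpa using (tendsto_const_div_atTop_nhds_zero_nat C).const_add b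
  filter_upwards [hlim.eventually_lt_const hba, eventually_gt_atTop 0] with n hn hn0
  have hsum : birkhoffSum T f n x - n * b ≤ C := by
    simpa [birkhoffSum, Finset.sum_sub_distrib] using hC ⟨n, rfl⟩
  calc birkhoffAverage ℝ T f n x = b + (birkhoffSum T f n x - n * b) / n := by
        rw [birkhoffAverage, smul_eq_mul]
        field_simp
        ring
    _ ≤ b + C / n := by gcongr
    _ < a := hn

theorem ae_tendsto_birkhoffAverage_of_ergodic (hT : Ergodic T μ) (hf : Integrable f μ) :
    ∀ᵐ x ∂μ, Tendsto (birkhoffAverage ℝ T f · x) atTop (𝓝 (∫ x, f x ∂μ)) := by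
  have hupper : ∀ᵐ x ∂μ, ∀ q : ℚ, ∫ x, f x ∂μ < q →
      ∀ᶠ n in atTop, birkhoffAverage ℝ T f n x < q :=
    ae_all_iff.2 fun q => eventually_imp_distrib_left.2 (ae_eventually_birkhoffAverage_lt hT hf)
  have hlower : ∀ᵐ x ∂μ, ∀ q : ℚ, ∫ x, (-f) x ∂μ < q →
      ∀ᶠ n in atTop, birkhoffAverage ℝ T (-f) n x < q :=
    ae_all_iff.2 fun q =>
      eventually_imp_distrib_left.2 (ae_eventually_birkhoffAverage_lt hT hf.neg)
  filter_upwards [hupper, hlower] with x hx_upper hx_lower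
  refine tendsto_order.2 ⟨fun a ha => ?_, fun a ha => ?_⟩
  · obtain ⟨q, hq, hqa⟩ := exists_rat_btwn (neg_lt_neg ha)
    filter_upwards [hx_lower q (by simpa [integral_neg] using hq)] with n hn
    rw [birkhoffAverage_neg, Pi.neg_apply, Pi.neg_apply] at hn
    linarith
  · obtain ⟨q, hq, hqa⟩ := exists_rat_btwn ha
    exact (hx_upper q hq).mono fun n hn => hn.trans hqa

end ErgodicTheorem

section Shift

variable {S : Type*}

/-- The shift on runs. The suffixes of a run are its orbit under the shift, so that frequencies
along a run are limits of Birkhoff averages. -/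
def shift (ω : ℕ → S) : ℕ → S := suffix ω 1

lemma iterate_shift (n : ℕ) (ω : ℕ → S) : shift^[n] ω = suffix ω n := by
  induction n generalizing ω with
  | zero => exact funext fun k => by simp [suffix]
  | succ n ih =>
    funext k
    simp only [Function.iterate_succ_apply, ih, shift, suffix]
    congr 1
    omega

lemma suffix_update (ω : ℕ → S) (n m : ℕ) (t : S) :
    suffix (Function.update ω (n + m) t) n = Function.update (suffix ω n) m t := by
  funext k
  simp [suffix, Function.update_apply]

lemma preimage_suffix_of_preimage_shift {A : Set (ℕ → S)} (hA : shift ⁻¹' A = A) (n : ℕ) :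
    (suffix · n) ⁻¹' A = A := by
  simpa only [Function.IsFixedPt, funext (iterate_shift n)] using
    Function.IsFixedPt.preimage_iterate hA n

lemma dependsOn_mem_cylinder (I : Finset ℕ) (D : Set (I → S)) :
    DependsOn (· ∈ cylinder (α := fun _ : ℕ => S) I D) (Set.Iic (I.sup id)) := fun ω η h => by
  have : I.restrict ω = I.restrict η :=
    funext fun i => h i (Finset.le_sup (f := id) i.2)
  simp only [mem_cylinder, this]

variable [MeasurableSpace S]

lemma measurable_suffix (n : ℕ) : Measurable fun ω : ℕ → S => suffix ω n :=
  measurable_pi_lambda _ fun i => measurable_pi_apply (n + i)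

lemma measurable_shift : Measurable (shift (S := S)) := measurable_suffix 1

lemma measure_ext_of_dependsOn_Iic {μ ν : Measure (ℕ → S)} [IsFiniteMeasure μ]
    (h : ∀ n C, MeasurableSet C → DependsOn (· ∈ C) (Set.Iic n) → μ C = ν C) : μ = ν := by
  refine ext_of_generate_finite _ generateFrom_measurableCylinders.symm
    isPiSystem_measurableCylinders (fun C hC => ?_) (h 0 _ .univ fun _ _ _ => rfl)
  obtain ⟨I, D, hD, rfl⟩ := (mem_measurableCylinders C).1 hC
  exact h _ _ (hD.cylinder I) (dependsOn_mem_cylinder I D)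

end Shift

section MarkovProperty

variable {S : Type*} [MeasurableSpace S] [DiscreteMeasurableSpace S] (Δ : S → PMF S)

instance isProbabilityMeasure_runMeasure (s : S) : IsProbabilityMeasure (runMeasure Δ s) := by
  unfold runMeasure
  infer_instance

/-- The law of the runs as a kernel in the initial state, so that `runKernel Δ ∘ₘ μ` is the law of
the runs with initial distribution `μ`. -/
noncomputable def runKernel : Kernel S (ℕ → S) := ⟨runMeasure Δ, .of_discrete⟩

lemma runKernel_apply (s : S) : runKernel Δ s = runMeasure Δ s := rfl

instance isMarkovKernel_runKernel : IsMarkovKernel (runKernel Δ) :=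
  ⟨isProbabilityMeasure_runMeasure Δ⟩

lemma ae_apply_zero_eq (s : S) : ∀ᵐ ω ∂runMeasure Δ s, ω 0 = s := by
  have hlaw : (runMeasure Δ s).map (Preorder.frestrictLe (π := fun _ : ℕ => S) 0) =
      (Measure.dirac s).map (MeasurableEquiv.piUnique fun _ : Finset.Iic 0 => S).symm := by
    rw [runMeasure, Kernel.trajMeasure, Measure.map_comp _ _ (by fun_prop),
      Kernel.traj_map_frestrictLe, Kernel.partialTraj_self, Measure.id_comp]
  rw [Measure.map_dirac' (MeasurableEquiv.measurable _)] at hlaw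
  have hstart : ∀ᵐ h ∂(runMeasure Δ s).map (Preorder.frestrictLe (π := fun _ : ℕ => S) 0),
      h ⟨0, Finset.mem_Iic.2 le_rfl⟩ = s := by
    have hmeas : MeasurableSet {h : Finset.Iic 0 → S | h ⟨0, Finset.mem_Iic.2 le_rfl⟩ = s} :=
      (measurable_pi_apply (X := fun _ => S) _) (measurableSet_singleton s)
    rw [hlaw, ae_dirac_iff hmeas]
    rfl
  exact ae_of_ae_map (by fun_prop) hstart

lemma lintegral_runMeasure_eq_lintegral_update (s : S) {n : ℕ} {F : (ℕ → S) → ℝ≥0∞}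
    (hF : Measurable F) (hFn : DependsOn F (Set.Iic (n + 1))) :
    ∫⁻ ω, F ω ∂runMeasure Δ s =
      ∫⁻ ω, ∫⁻ t, F (Function.update ω (n + 1) t) ∂stepKernel Δ (ω n) ∂runMeasure Δ s := by
  let extend (h : Finset.Iic n → S) (i : ℕ) : S := h ⟨min i n, Finset.mem_Iic.2 (min_le_right i n)⟩
  let glue (p : (Finset.Iic n → S) × S) : ℕ → S := Function.update (extend p.1) (n + 1) p.2
  have hglue : Measurable fun p => F (glue p) := by
    refine hF.comp (measurable_pi_lambda _ fun i => ?_)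
    by_cases hi : i = n + 1
    · subst hi
      simpa [glue] using measurable_snd
    · simp only [glue, Function.update_of_ne hi, extend]
      fun_prop
  have glue_frestrictLe (ω : ℕ → S) (t : S) :
      F (glue (Preorder.frestrictLe n ω, t)) = F (Function.update ω (n + 1) t) := by
    refine hFn fun i hi => ?_
    rcases Nat.le_succ_iff.1 hi with hin | rfl
    · simp [glue, extend, Function.update_apply, hin]
    · simp [glue]
  calc ∫⁻ ω, F ω ∂runMeasure Δ s
      = ∫⁻ ω, F (glue (Preorder.frestrictLe n ω, ω (n + 1))) ∂runMeasure Δ s := by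
        simp only [glue_frestrictLe, Function.update_eq_self]
    _ = ∫⁻ p, F (glue p)
          ∂(runMeasure Δ s).map fun ω => (Preorder.frestrictLe n ω, ω (n + 1)) :=
        (lintegral_map hglue (by fun_prop)).symm
    _ = ∫⁻ ω, ∫⁻ t, F (glue (Preorder.frestrictLe n ω, t)) ∂stepKernel Δ (ω n)
          ∂runMeasure Δ s := by
        rw [runMeasure, ← Kernel.map_frestrictLe_trajMeasure_compProd_eq_map_trajMeasure,
          Measure.lintegral_compProd hglue,
          lintegral_map hglue.lintegral_kernel_prod_right' (by fun_prop)]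
        rfl
    _ = _ := by simp only [glue_frestrictLe]

variable {Δ} {s : S} {n : ℕ} {C : Set (ℕ → S)}

lemma setLIntegral_runMeasure_eq_lintegral_update (hC : MeasurableSet C)
    (hCn : DependsOn (· ∈ C) (Set.Iic n)) {F : (ℕ → S) → ℝ≥0∞} (hF : Measurable F)
    (hFn : DependsOn F (Set.Iic (n + 1))) :
    ∫⁻ ω in C, F ω ∂runMeasure Δ s =
      ∫⁻ ω in C, ∫⁻ t, F (Function.update ω (n + 1) t) ∂stepKernel Δ (ω n) ∂runMeasure Δ s := by
  classical
  have hind : DependsOn (C.indicator F) (Set.Iic (n + 1)) := fun ω η h => by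
    have hmem : (ω ∈ C) = (η ∈ C) := hCn fun i hi => h i (Set.Iic_subset_Iic.2 n.le_succ hi)
    simp only [Set.indicator_apply, hmem, hFn h]
  have hupdate (ω : ℕ → S) (t : S) : Function.update ω (n + 1) t ∈ C ↔ ω ∈ C :=
    iff_of_eq (hCn fun i hi => Function.update_of_ne (Nat.lt_succ_of_le hi).ne t ω)
  rw [← lintegral_indicator hC, ← lintegral_indicator hC,
    lintegral_runMeasure_eq_lintegral_update Δ s (hF.indicator hC) hind]
  refine lintegral_congr fun ω => ?_
  by_cases hω : ω ∈ C <;> simp [hupdate, hω]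

lemma measurable_lintegral_update {F : (ℕ → S) → ℝ≥0∞} (hF : Measurable F) (m n : ℕ) :
    Measurable fun ω => ∫⁻ t, F (Function.update ω m t) ∂stepKernel Δ (ω n) := by
  have hupdate : Measurable fun p : (ℕ → S) × S => Function.update p.1 m p.2 := by
    fun_prop
  exact (hF.comp hupdate).lintegral_kernel_prod_right'
    (κ := (stepKernel Δ).comap (fun ω : ℕ → S => ω n) (measurable_pi_apply n))

lemma setLIntegral_comp_suffix (hC : MeasurableSet C) (hCn : DependsOn (· ∈ C) (Set.Iic n))
    {m : ℕ} {F : (ℕ → S) → ℝ≥0∞} (hF : Measurable F) (hFm : DependsOn F (Set.Iic m)) :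
    ∫⁻ ω in C, F (suffix ω n) ∂runMeasure Δ s =
      ∫⁻ ω in C, ∫⁻ η, F η ∂runMeasure Δ (ω n) ∂runMeasure Δ s := by
  induction m generalizing F with
  | zero =>
    refine lintegral_congr fun ω => ?_
    have hconst : ∀ᵐ η ∂runMeasure Δ (ω n), F η = F (suffix ω n) := by
      filter_upwards [ae_apply_zero_eq Δ (ω n)] with η hη
      refine hFm fun i hi => ?_
      obtain rfl : i = 0 := Nat.le_zero.1 hi
      exact hη
    rw [lintegral_congr_ae hconst, lintegral_const, measure_univ, mul_one]
  | succ m ih =>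
    let F' (η : ℕ → S) : ℝ≥0∞ := ∫⁻ t, F (Function.update η (m + 1) t) ∂stepKernel Δ (η m)
    have hF' : Measurable F' := measurable_lintegral_update hF (m + 1) m
    have hF'm : DependsOn F' (Set.Iic m) := fun ω η h => by
      have hFupdate (t : S) : F (Function.update ω (m + 1) t) = F (Function.update η (m + 1) t) :=
        hFm fun i hi => by
          rcases Nat.le_succ_iff.1 hi with him | rfl
          · simp only [Function.update_apply, h i him]
          · simp
      simp only [F', hFupdate, h m (Set.mem_Iic.2 le_rfl)]
    have hFsuffix : DependsOn (fun ω : ℕ → S => F (suffix ω n)) (Set.Iic (n + m + 1)) :=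
      fun ω η h => hFm fun i hi => h (n + i) (by simp only [Set.mem_Iic] at hi ⊢; omega)
    calc ∫⁻ ω in C, F (suffix ω n) ∂runMeasure Δ s
        = ∫⁻ ω in C, ∫⁻ t, F (suffix (Function.update ω (n + m + 1) t) n)
            ∂stepKernel Δ (ω (n + m)) ∂runMeasure Δ s :=
          setLIntegral_runMeasure_eq_lintegral_update hC
            (hCn.mono (Set.Iic_subset_Iic.2 (n.le_add_right m))) (hF.comp (measurable_suffix n))
            hFsuffix
      _ = ∫⁻ ω in C, F' (suffix ω n) ∂runMeasure Δ s := by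
          simp only [add_assoc, suffix_update]
          rfl
      _ = ∫⁻ ω in C, ∫⁻ η, F' η ∂runMeasure Δ (ω n) ∂runMeasure Δ s := ih hF' hF'm
      _ = _ := by simp only [F', ← lintegral_runMeasure_eq_lintegral_update Δ _ hF hFm]

/-- The Markov property at time `n`, in which `C` stands for any event determined by the history up
to time `n`. -/
theorem map_suffix_restrict_runMeasure (hC : MeasurableSet C)
    (hCn : DependsOn (· ∈ C) (Set.Iic n)) :
    ((runMeasure Δ s).restrict C).map (suffix · n) =
      runKernel Δ ∘ₘ ((runMeasure Δ s).restrict C).map (· n) := by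
  refine measure_ext_of_dependsOn_Iic fun m A hA hAm => ?_
  have hind : DependsOn (A.indicator (1 : (ℕ → S) → ℝ≥0∞)) (Set.Iic m) := fun ω η h => by
    classical
    simp only [Set.indicator_apply, hAm h, Pi.one_apply]
  have hind_meas : Measurable (A.indicator (1 : (ℕ → S) → ℝ≥0∞)) := measurable_one.indicator hA
  rw [← lintegral_indicator_one hA, lintegral_map hind_meas (measurable_suffix n),
    setLIntegral_comp_suffix hC hCn hind_meas hind,
    Measure.bind_apply hA (runKernel Δ).aemeasurable,
    lintegral_map ((runKernel Δ).measurable_coe hA) (measurable_pi_apply n)]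
  simp only [lintegral_indicator_one hA, runKernel_apply]

lemma map_suffix_runMeasure (s : S) (n : ℕ) :
    (runMeasure Δ s).map (suffix · n) = runKernel Δ ∘ₘ (runMeasure Δ s).map (· n) := by
  simpa only [Measure.restrict_univ] using
    map_suffix_restrict_runMeasure (Δ := Δ) (s := s) (n := n) .univ fun _ _ _ => rfl

lemma map_apply_one_runMeasure (s : S) : (runMeasure Δ s).map (· 1) = stepKernel Δ s := by
  refine Measure.ext fun E hE => ?_
  have hind : Measurable fun ω : ℕ → S => E.indicator (1 : S → ℝ≥0∞) (ω 1) :=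
    (measurable_one.indicator hE).comp (measurable_pi_apply 1)
  rw [← lintegral_indicator_one hE, lintegral_map (measurable_one.indicator hE) (by fun_prop),
    lintegral_runMeasure_eq_lintegral_update Δ s (n := 0) hind fun ω η h => by
      rw [h 1 (Set.mem_Iic.2 le_rfl)]]
  have hstep : ∀ᵐ ω ∂runMeasure Δ s, ∫⁻ t, E.indicator (1 : S → ℝ≥0∞)
      (Function.update ω (0 + 1) t 1) ∂stepKernel Δ (ω 0) = stepKernel Δ s E := by
    filter_upwards [ae_apply_zero_eq Δ s] with ω hω
    simp only [zero_add, Function.update_self, hω, lintegral_indicator_one hE]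
  rw [lintegral_congr_ae hstep, lintegral_const, measure_univ, mul_one]

lemma map_shift_runKernel : (runKernel Δ).map shift = runKernel Δ ∘ₖ stepKernel Δ := by
  refine Kernel.ext fun s => ?_
  rw [Kernel.map_apply _ measurable_shift, Kernel.comp_apply, ← map_apply_one_runMeasure]
  exact map_suffix_runMeasure s 1

lemma ae_suffix_of_forall_ae {p : (ℕ → S) → Prop} (hp : MeasurableSet {ω | p ω})
    (h : ∀ t, ∀ᵐ ω ∂runMeasure Δ t, p ω) (s : S) : ∀ᵐ ω ∂runMeasure Δ s, ∀ n, p (suffix ω n) := by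
  refine ae_all_iff.2 fun n => ae_of_ae_map (measurable_suffix n).aemeasurable ?_
  rw [map_suffix_runMeasure]
  exact Measure.ae_comp_of_ae_ae hp (ae_of_all _ h)

lemma measurePreserving_shift {μ : Measure S} (hμ : (stepKernel Δ).Invariant μ) :
    MeasurePreserving shift (runKernel Δ ∘ₘ μ) (runKernel Δ ∘ₘ μ) := by
  refine ⟨measurable_shift, ?_⟩
  rw [Measure.map_comp _ _ measurable_shift, map_shift_runKernel, ← Measure.comp_assoc,
    hμ.def]

end MarkovProperty

section RowStochastic

open Matrix

variable {R n : Type*} [Field R] [LinearOrder R] [IsStrictOrderedRing R] [Fintype n]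
  [DecidableEq n] {M : Matrix n n R}

lemma exists_vecMul_eq_of_mem_rowStochastic [Nonempty n] (hM : M ∈ rowStochastic R n) :
    ∃ v ≠ 0, v ᵥ* M = v := by
  have hdet : (1 - M).det = 0 := by
    refine exists_mulVec_eq_zero_iff.1 ⟨1, one_ne_zero, ?_⟩
    rw [sub_mulVec, one_mulVec, one_vecMul_of_mem_rowStochastic hM, sub_self]
  obtain ⟨v, hv, hvM⟩ := exists_vecMul_eq_zero_iff.2 hdet
  rw [vecMul_sub, vecMul_one, sub_eq_zero] at hvM
  exact ⟨v, hv, hvM.symm⟩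

lemma abs_vecMul_eq_of_mem_rowStochastic (hM : M ∈ rowStochastic R n) {v : n → R}
    (hv : v ᵥ* M = v) : |v| ᵥ* M = |v| := by
  -- `|v| ≤ |v| ᵥ* M` entrywise, and the entries of both sides have the same sum.
  have hle (t : n) : |v t| ≤ (|v| ᵥ* M) t := calc
    |v t| = |∑ s, v s * M s t| := congrArg abs (congrFun hv t).symm
    _ ≤ ∑ s, |v s * M s t| := Finset.abs_sum_le_sum_abs _ _
    _ = ∑ s, |v s| * M s t := by
      simp only [abs_mul, abs_of_nonneg (nonneg_of_mem_rowStochastic hM)]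
  have hsum : ∑ t, |v t| = ∑ t, (|v| ᵥ* M) t := by
    have h := dotProduct_mulVec |v| M 1
    rw [one_vecMul_of_mem_rowStochastic hM, dotProduct_one, dotProduct_one] at h
    exact h
  exact funext fun t => ((Finset.sum_eq_sum_iff_of_le fun t _ => hle t).1 hsum t
    (Finset.mem_univ t)).symm

theorem exists_mem_stdSimplex_vecMul_eq_of_mem_rowStochastic [Nonempty n]
    (hM : M ∈ rowStochastic R n) : ∃ w ∈ stdSimplex R n, w ᵥ* M = w := by
  obtain ⟨v, hv, hvM⟩ := exists_vecMul_eq_of_mem_rowStochastic hM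
  have hpos : 0 < ∑ t, |v t| := by
    obtain ⟨t, ht⟩ := Function.ne_iff.1 hv
    exact Finset.sum_pos' (fun _ _ => abs_nonneg _) ⟨t, Finset.mem_univ t, abs_pos.2 ht⟩
  refine ⟨(∑ t, |v t|)⁻¹ • |v|, ⟨fun t => ?_, ?_⟩, ?_⟩
  · exact mul_nonneg (inv_nonneg.2 hpos.le) (abs_nonneg (v t))
  · simp only [Pi.smul_apply, Pi.abs_apply, smul_eq_mul, ← Finset.mul_sum]
    exact inv_mul_cancel₀ hpos.ne'
  · rw [smul_vecMul, abs_vecMul_eq_of_mem_rowStochastic hM hvM]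

end RowStochastic

section BSCC

variable {S : Type*} {Δ : S → PMF S} {B : Finset S}

lemma IsBSCC.mem_of_step (hB : IsBSCC Δ B) {s t : S} (hs : s ∈ B) (hst : 0 < Δ s t) : t ∈ B :=
  (hB.2 s hs).subset (Relation.ReflTransGen.single hst)

lemma IsBSCC.reachable (hB : IsBSCC Δ B) {s t : S} (hs : s ∈ B) (ht : t ∈ B) : Reachable Δ s t :=
  (hB.2 s hs).superset ht

variable [MeasurableSpace S] [DiscreteMeasurableSpace S]

lemma ae_stepKernel_iff {s : S} {p : S → Prop} :
    (∀ᵐ t ∂stepKernel Δ s, p t) ↔ ∀ t, 0 < Δ s t → p t := by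
  change (Δ s).toMeasure {t | p t}ᶜ = 0 ↔ _
  rw [PMF.toMeasure_apply_eq_zero_iff _ .of_discrete, Set.disjoint_compl_right_iff_subset]
  simp only [pos_iff_ne_zero]
  rfl

lemma IsBSCC.ae_stepKernel_mem (hB : IsBSCC Δ B) {s : S} (hs : s ∈ B) :
    ∀ᵐ t ∂stepKernel Δ s, t ∈ B :=
  ae_stepKernel_iff.2 fun _ => hB.mem_of_step hs

lemma IsBSCC.ae_forall_apply_mem (hB : IsBSCC Δ B) {s : S} (hs : s ∈ B) :
    ∀ᵐ ω ∂runMeasure Δ s, ∀ n, ω n ∈ B := by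
  have hstep (t : S) : ∀ᵐ ω ∂runMeasure Δ t, ω 0 ∈ B → ω 1 ∈ B := by
    by_cases ht : t ∈ B
    · have h1 : ∀ᵐ ω ∂runMeasure Δ t, ω 1 ∈ B :=
        ae_of_ae_map (measurable_pi_apply 1).aemeasurable
          (map_apply_one_runMeasure (Δ := Δ) t ▸ hB.ae_stepKernel_mem ht)
      exact h1.mono fun _ h _ => h
    · filter_upwards [ae_apply_zero_eq Δ t] with ω h0 h
      exact absurd (h0 ▸ h) ht
  have hmeas (n : ℕ) : MeasurableSet {ω : ℕ → S | ω n ∈ B} :=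
    measurable_pi_apply n (.of_discrete (s := (B : Set S)))
  filter_upwards [ae_apply_zero_eq Δ s,
    ae_suffix_of_forall_ae ((hmeas 0).imp (hmeas 1)) hstep s] with ω h0 hω n
  induction n with
  | zero => exact h0.symm ▸ hs
  | succ n ih => exact hω n ih

lemma IsBSCC.eq_of_harmonic (hB : IsBSCC Δ B) {u : S → ℝ≥0∞} (hu : ∀ s ∈ B, u s ≠ ∞)
    (hharm : ∀ s ∈ B, ∫⁻ t, u t ∂stepKernel Δ s = u s) {s t : S} (hs : s ∈ B) (ht : t ∈ B) :
    u s = u t := by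
  obtain ⟨m, hm, hmax⟩ := B.exists_max_image u hB.1
  have hstep {s t : S} (hs : s ∈ B) (hsm : u s = u m) (hst : 0 < Δ s t) : u t = u m := by
    have hle : u ≤ᵐ[stepKernel Δ s] fun _ => u m := (hB.ae_stepKernel_mem hs).mono hmax
    refine ae_stepKernel_iff.1 (ae_eq_of_ae_le_of_lintegral_le hle ?_ aemeasurable_const ?_) t hst
    · exact hharm s hs ▸ hu s hs
    · rw [hharm s hs, hsm, lintegral_const, measure_univ, mul_one]
  have heq {t : S} (ht : t ∈ B) : u t = u m := by
    suffices ∀ {t}, Reachable Δ m t → t ∈ B ∧ u t = u m from (this (hB.reachable hm ht)).2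
    intro t hmt
    induction hmt with
    | refl => exact ⟨hm, rfl⟩
    | tail _ hst ih => exact ⟨hB.mem_of_step ih.1 hst, hstep ih.1 ih.2 hst⟩
  rw [heq hs, heq ht]

lemma IsBSCC.runMeasure_apply_eq (hB : IsBSCC Δ B) {A : Set (ℕ → S)} (hA : MeasurableSet A)
    (hinv : shift ⁻¹' A = A) {s t : S} (hs : s ∈ B) (ht : t ∈ B) :
    runMeasure Δ s A = runMeasure Δ t A := by
  refine hB.eq_of_harmonic (u := fun s => runMeasure Δ s A) (fun _ _ => measure_ne_top _ _)
    (fun s _ => ?_) hs ht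
  have h := congrArg (· s A) (map_shift_runKernel (Δ := Δ))
  simp only [Kernel.map_apply' _ measurable_shift s hA, hinv, Kernel.comp_apply' _ _ s hA] at h
  exact h.symm

lemma IsBSCC.restrict_runMeasure_eq_smul (hB : IsBSCC Δ B) {A : Set (ℕ → S)} (hA : MeasurableSet A)
    (hinv : shift ⁻¹' A = A) {s : S} (hs : s ∈ B) :
    (runMeasure Δ s).restrict A = runMeasure Δ s A • runMeasure Δ s := by
  refine measure_ext_of_dependsOn_Iic fun n C hC hCn => ?_
  have hconst : ∀ᵐ ω ∂(runMeasure Δ s).restrict C, runMeasure Δ (ω n) A = runMeasure Δ s A :=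
    ae_restrict_of_ae ((hB.ae_forall_apply_mem hs).mono fun ω hω =>
      hB.runMeasure_apply_eq hA hinv (hω n) hs)
  calc (runMeasure Δ s).restrict A C
      = ((runMeasure Δ s).restrict C).map (suffix · n) A := by
        rw [Measure.map_apply (measurable_suffix n) hA, preimage_suffix_of_preimage_shift hinv,
          Measure.restrict_apply hC, Measure.restrict_apply hA, Set.inter_comm]
    _ = ∫⁻ ω in C, runMeasure Δ (ω n) A ∂runMeasure Δ s := by
        rw [map_suffix_restrict_runMeasure hC hCn,
          Measure.bind_apply hA (runKernel Δ).aemeasurable,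
          lintegral_map ((runKernel Δ).measurable_coe hA) (measurable_pi_apply n)]
        rfl
    _ = runMeasure Δ s A * runMeasure Δ s C := by
        rw [lintegral_congr_ae hconst, lintegral_const, Measure.restrict_apply_univ]

theorem IsBSCC.runMeasure_eq_zero_or_one (hB : IsBSCC Δ B) {A : Set (ℕ → S)} (hA : MeasurableSet A)
    (hinv : shift ⁻¹' A = A) :
    (∀ s ∈ B, runMeasure Δ s A = 0) ∨ ∀ s ∈ B, runMeasure Δ s A = 1 := by
  obtain ⟨b, hb⟩ := hB.1
  have hcompl : runMeasure Δ b A * runMeasure Δ b Aᶜ = 0 := by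
    rw [← smul_eq_mul, ← Measure.smul_apply, ← hB.restrict_runMeasure_eq_smul hA hinv hb,
      Measure.restrict_apply hA.compl, Set.compl_inter_self, measure_empty]
  refine (mul_eq_zero.1 hcompl).imp (fun h s hs => ?_) fun h s hs => ?_
  · rw [hB.runMeasure_apply_eq hA hinv hs hb, h]
  · rw [hB.runMeasure_apply_eq hA hinv hs hb, (prob_compl_eq_zero_iff hA).1 h]

end BSCC

section StationaryDistribution

variable {S : Type*} {Δ : S → PMF S} {B : Finset S}

/-- The matrix of the transition probabilities between the states of `B`, whose fixed row vectors
in the standard simplex are the stationary distributions on a bottom component `B`. -/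
noncomputable def transitionMatrix (Δ : S → PMF S) (B : Finset S) : Matrix B B ℝ :=
  .of fun s t => (Δ s t).toReal

lemma IsBSCC.apply_eq_zero_of_notMem (hB : IsBSCC Δ B) {s t : S} (hs : s ∈ B) (ht : t ∉ B) :
    Δ s t = 0 :=
  of_not_not fun h => ht (hB.mem_of_step hs (pos_iff_ne_zero.2 h))

lemma IsBSCC.transitionMatrix_mem_rowStochastic [DecidableEq S] (hB : IsBSCC Δ B) :
    transitionMatrix Δ B ∈ Matrix.rowStochastic ℝ B := by
  refine Matrix.mem_rowStochastic_iff_sum.2 ⟨fun _ _ => ENNReal.toReal_nonneg, fun s => ?_⟩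
  calc ∑ t : B, (Δ s t).toReal = ∑ t ∈ B, (Δ s t).toReal :=
        Finset.sum_coe_sort B fun t => (Δ s t).toReal
    _ = (∑' t, Δ s t).toReal := by
        rw [tsum_eq_sum fun t ht => hB.apply_eq_zero_of_notMem s.2 ht,
          ENNReal.toReal_sum fun t _ => (Δ s).apply_ne_top t]
    _ = 1 := by rw [(Δ s).tsum_coe, ENNReal.toReal_one]

variable [MeasurableSpace S] [DiscreteMeasurableSpace S]

lemma IsBSCC.stepKernel_eq_sum_dirac (hB : IsBSCC Δ B) {s : S} (hs : s ∈ B) :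
    stepKernel Δ s = ∑ t : B, Δ s t • Measure.dirac (t : S) := by
  refine Measure.ext fun E hE => ?_
  change (Δ s).toMeasure E = _
  rw [PMF.toMeasure_apply _ hE, Finset.sum_coe_sort B fun t => Δ s t • Measure.dirac t,
    tsum_eq_sum fun t ht => by
      rw [Set.indicator_apply_eq_zero]
      exact fun _ => hB.apply_eq_zero_of_notMem hs ht]
  rw [Measure.finsetSum_apply]
  refine Finset.sum_congr rfl fun t _ => ?_
  by_cases ht : t ∈ E <;> simp [ht]

theorem IsBSCC.exists_invariant (hB : IsBSCC Δ B) :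
    ∃ μ : Measure S, IsProbabilityMeasure μ ∧ (stepKernel Δ).Invariant μ ∧ ∀ᵐ s ∂μ, s ∈ B := by
  classical
  have : Nonempty B := hB.1.to_subtype
  obtain ⟨w, ⟨hw_nonneg, hw_sum⟩, hw⟩ :=
    exists_mem_stdSimplex_vecMul_eq_of_mem_rowStochastic hB.transitionMatrix_mem_rowStochastic
  have hw_step (t : B) : ∑ s : B, ENNReal.ofReal (w s) * Δ s t = ENNReal.ofReal (w t) := by
    rw [← congrFun hw t]
    simp only [Matrix.vecMul, dotProduct, transitionMatrix, Matrix.of_apply]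
    rw [ENNReal.ofReal_sum_of_nonneg fun s _ => mul_nonneg (hw_nonneg s) ENNReal.toReal_nonneg]
    simp only [ENNReal.ofReal_mul (hw_nonneg _), ENNReal.ofReal_toReal ((Δ _).apply_ne_top t)]
  refine ⟨∑ t : B, ENNReal.ofReal (w t) • Measure.dirac (t : S), ⟨?_⟩, ?_, ?_⟩
  · rw [Measure.finsetSum_apply]
    simp only [Measure.smul_apply, measure_univ, smul_eq_mul, mul_one]
    rw [← ENNReal.ofReal_sum_of_nonneg fun t _ => hw_nonneg t, hw_sum, ENNReal.ofReal_one]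
  · calc stepKernel Δ ∘ₘ ∑ s : B, ENNReal.ofReal (w s) • Measure.dirac (s : S)
        = ∑ s : B, ENNReal.ofReal (w s) • stepKernel Δ s := by
          refine Measure.ext fun E hE => ?_
          rw [Measure.bind_apply hE (stepKernel Δ).aemeasurable, lintegral_finsetSum_measure,
            Measure.finsetSum_apply]
          simp only [lintegral_smul_measure, lintegral_dirac, Measure.smul_apply]
      _ = ∑ s : B, ENNReal.ofReal (w s) • ∑ t : B, Δ s t • Measure.dirac (t : S) :=
          Finset.sum_congr rfl fun s _ => by rw [hB.stepKernel_eq_sum_dirac s.2]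
      _ = ∑ t : B, (∑ s : B, ENNReal.ofReal (w s) * Δ s t) • Measure.dirac (t : S) := by
          simp only [Finset.smul_sum, smul_smul, Finset.sum_smul]
          exact Finset.sum_comm
      _ = _ := by simp only [hw_step]
  · simp only [ae_iff, Measure.finsetSum_apply, Measure.smul_apply]
    exact Finset.sum_eq_zero fun t _ => by simp

end StationaryDistribution

section Ergodicity

variable {S : Type*} {f : (ℕ → S) → ℝ}

lemma tendsto_birkhoffAverage_suffix_iff {c : ℝ} (ω : ℕ → S) (n : ℕ) :
    Tendsto (birkhoffAverage ℝ shift f · (suffix ω n)) atTop (𝓝 c) ↔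
      Tendsto (birkhoffAverage ℝ shift f · ω) atTop (𝓝 c) :=
  iff_of_eq (congrArg (ω ∈ ·) (preimage_suffix_of_preimage_shift
    (A := {ω | Tendsto (birkhoffAverage ℝ shift f · ω) atTop (𝓝 c)})
    (Set.ext tendsto_birkhoffAverage_apply_iff) n))

variable [MeasurableSpace S]

lemma measurableSet_tendsto_birkhoffAverage_shift (hf : Measurable f) (c : ℝ) :
    MeasurableSet {ω | Tendsto (birkhoffAverage ℝ shift f · ω) atTop (𝓝 c)} :=
  measurableSet_tendsto _ fun n =>
    (Finset.measurable_fun_sum (Finset.range n) fun k _ =>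
      hf.comp (measurable_shift.iterate k)).const_smul (n : ℝ)⁻¹

variable [DiscreteMeasurableSpace S] {Δ : S → PMF S} {B : Finset S} {μ : Measure S}

lemma IsBSCC.ergodic_shift (hB : IsBSCC Δ B) (hμ : (stepKernel Δ).Invariant μ)
    (hμB : ∀ᵐ s ∂μ, s ∈ B) : Ergodic shift (runKernel Δ ∘ₘ μ) := by
  refine ⟨measurePreserving_shift hμ, ⟨fun A hA hinv => eventuallyConst_set.2 ?_⟩⟩
  rcases hB.runMeasure_eq_zero_or_one hA hinv with hzero | hone
  · refine Or.inr (Measure.ae_comp_of_ae_ae hA.compl ?_)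
    exact hμB.mono fun s hs => measure_eq_zero_iff_ae_notMem.1 (hzero s hs)
  · refine Or.inl (Measure.ae_comp_of_ae_ae hA ?_)
    exact hμB.mono fun s hs => (mem_ae_iff_prob_eq_one hA).2 (hone s hs)

variable [IsProbabilityMeasure μ]

lemma IsBSCC.ae_tendsto_birkhoffAverage (hB : IsBSCC Δ B) (hμ : (stepKernel Δ).Invariant μ)
    (hμB : ∀ᵐ s ∂μ, s ∈ B) (hf : Measurable f) (hfμ : Integrable f (runKernel Δ ∘ₘ μ)) {s : S}
    (hs : s ∈ B) :
    ∀ᵐ ω ∂runMeasure Δ s, Tendsto (birkhoffAverage ℝ shift f · ω) atTop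
      (𝓝 (∫ ω, f ω ∂(runKernel Δ ∘ₘ μ))) := by
  have hmeas := measurableSet_tendsto_birkhoffAverage_shift hf (∫ ω, f ω ∂(runKernel Δ ∘ₘ μ))
  have hergodic := Measure.ae_ae_of_ae_comp
    (ae_tendsto_birkhoffAverage_of_ergodic (hB.ergodic_shift hμ hμB) hfμ)
  obtain ⟨t, htB, ht⟩ := (hμB.and hergodic).exists
  refine (mem_ae_iff_prob_eq_one hmeas).2 ?_
  rw [hB.runMeasure_apply_eq hmeas (Set.ext tendsto_birkhoffAverage_apply_iff) hs htB]
  exact (mem_ae_iff_prob_eq_one hmeas).1 ht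

theorem IsBSCC.ae_tendsto_birkhoffAverage_of_exists_mem (hB : IsBSCC Δ B)
    (hμ : (stepKernel Δ).Invariant μ) (hμB : ∀ᵐ s ∂μ, s ∈ B) (hf : Measurable f)
    (hfμ : Integrable f (runKernel Δ ∘ₘ μ)) (s : S) :
    ∀ᵐ ω ∂runMeasure Δ s, (∃ n, ω n ∈ B) → Tendsto (birkhoffAverage ℝ shift f · ω) atTop
      (𝓝 (∫ ω, f ω ∂(runKernel Δ ∘ₘ μ))) := by
  have hstart (t : S) : ∀ᵐ ω ∂runMeasure Δ t, ω 0 ∈ B →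
      Tendsto (birkhoffAverage ℝ shift f · ω) atTop (𝓝 (∫ ω, f ω ∂(runKernel Δ ∘ₘ μ))) := by
    by_cases ht : t ∈ B
    · exact (hB.ae_tendsto_birkhoffAverage hμ hμB hf hfμ ht).mono fun _ h _ => h
    · filter_upwards [ae_apply_zero_eq Δ t] with ω h0 h
      exact absurd (h0 ▸ h) ht
  have hmeas : MeasurableSet {ω : ℕ → S | ω 0 ∈ B} :=
    measurable_pi_apply 0 (.of_discrete (s := (B : Set S)))
  filter_upwards [ae_suffix_of_forall_ae
    (hmeas.imp (measurableSet_tendsto_birkhoffAverage_shift hf _)) hstart s] with ω hω ⟨n, hn⟩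
  exact (tendsto_birkhoffAverage_suffix_iff ω n).1 (hω n hn)

end Ergodicity

section Frequency

lemma freq_indicator_suffix_eq_of_tendsto {S : Type*} {A : Set (ℕ → S)} {ω : ℕ → S} {c : ℝ}
    (h : Tendsto (birkhoffAverage ℝ shift (A.indicator 1) · ω) atTop (𝓝 c)) :
    freq (Set.indicator {i : ℕ | suffix ω i ∈ A} 1) = c := by
  refine Tendsto.liminf_eq (h.congr fun n => ?_)
  simp only [birkhoffAverage, birkhoffSum, iterate_shift, smul_eq_mul, one_div]
  rfl

lemma measurable_freq {α : Type*} [MeasurableSpace α] {x : α → ℕ → ℝ}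
    (hx : ∀ i, Measurable fun a => x a i) : Measurable fun a => freq (x a) :=
  Measurable.liminf fun _ => (Finset.measurable_fun_sum _ fun i _ => hx i).const_mul _

variable {S : Type*} [MeasurableSpace S] [DiscreteMeasurableSpace S]

lemma measurableSet_sat {AP : Type*} (ν : S → Set AP) (φ : Formula AP) :
    MeasurableSet {ω : ℕ → S | Sat ν φ ω} := by
  have hsuffix {φ : Formula AP} (h : MeasurableSet {ω : ℕ → S | Sat ν φ ω}) (n : ℕ) :
      MeasurableSet {ω : ℕ → S | Sat ν φ (suffix ω n)} := measurable_suffix n h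
  induction φ with
  | atom a => exact measurable_pi_apply (X := fun _ => S) 0 (.of_discrete (s := {s | a ∈ ν s}))
  | neg φ hφ => exact hφ.compl
  | or φ ψ hφ hψ => exact hφ.union hψ
  | next φ hφ => exact hsuffix hφ 1
  | untl φ ψ hφ hψ =>
    simp only [Sat, Set.ofPred_exists, Set.ofPred_and, Set.ofPred_forall]
    exact .iUnion fun k => (hsuffix hψ k).inter (.iInter fun l => .iInter fun _ => hsuffix hφ l)
  | freqG p φ hφ =>
    exact measurableSet_le measurable_const
      (measurable_freq fun i => measurable_one.indicator (hsuffix hφ i))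

variable {Δ : S → PMF S} {B : Finset S} {μ : Measure S} [IsProbabilityMeasure μ]

lemma measureReal_runKernel_comp (hμB : ∀ᵐ s ∂μ, s ∈ B) {A : Set (ℕ → S)}
    (hA : MeasurableSet A) :
    (runKernel Δ ∘ₘ μ).real A = ∑ t ∈ B, μ.real {t} * (runMeasure Δ t).real A := by
  have hsum : (runKernel Δ ∘ₘ μ) A = ∑ t ∈ B, runMeasure Δ t A * μ {t} := by
    rw [Measure.bind_apply hA (runKernel Δ).aemeasurable, ← lintegral_finset,
      Measure.restrict_eq_self_of_ae_mem hμB]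
    rfl
  rw [measureReal_def, hsum, ENNReal.toReal_sum fun t _ =>
    ENNReal.mul_ne_top (measure_ne_top _ _) (measure_ne_top _ _)]
  simp only [ENNReal.toReal_mul, mul_comm, measureReal_def]

theorem IsBSCC.ae_freq_indicator_suffix_eq (hB : IsBSCC Δ B) (hμ : (stepKernel Δ).Invariant μ)
    (hμB : ∀ᵐ s ∂μ, s ∈ B) {A : Set (ℕ → S)} (hA : MeasurableSet A) (s : S) :
    ∀ᵐ ω ∂runMeasure Δ s, (∃ n, ω n ∈ B) →
      freq (Set.indicator {i : ℕ | suffix ω i ∈ A} 1) =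
        ∑ t ∈ B, μ.real {t} * (runMeasure Δ t).real A := by
  have hint : Integrable (A.indicator 1) (runKernel Δ ∘ₘ μ) :=
    (integrable_const (1 : ℝ)).indicator hA
  filter_upwards [hB.ae_tendsto_birkhoffAverage_of_exists_mem hμ hμB
    (measurable_one.indicator hA) hint s] with ω hω hn
  rw [freq_indicator_suffix_eq_of_tendsto (hω hn), integral_indicator_one hA,
    measureReal_runKernel_comp hμB hA]

lemma IsBSCC.steadyFreq_eq (hB : IsBSCC Δ B) (hμ : (stepKernel Δ).Invariant μ)
    (hμB : ∀ᵐ s ∂μ, s ∈ B) {t : S} (ht : t ∈ B) : steadyFreq Δ t = μ.real {t} := by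
  classical
  have hA : MeasurableSet {ω : ℕ → S | ω 0 = t} :=
    measurable_pi_apply (X := fun _ => S) 0 (measurableSet_singleton t)
  have hstart (s : S) : (runMeasure Δ s).real {ω | ω 0 = t} = if s = t then 1 else 0 := by
    have hae : {ω : ℕ → S | ω 0 = t} =ᵐ[runMeasure Δ s] {_ω | s = t} :=
      (ae_apply_zero_eq Δ s).mono fun _ h => congrArg (· = t) h
    rw [measureReal_congr hae]
    split_ifs with hst <;> simp [hst]
  have hfreq : ∀ᵐ ω ∂runMeasure Δ t, freq (Set.indicator {i : ℕ | ω i = t} 1) = μ.real {t} := by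
    filter_upwards [hB.ae_freq_indicator_suffix_eq hμ hμB hA t, ae_apply_zero_eq Δ t]
      with ω hω h0
    refine (hω ⟨0, h0.symm ▸ ht⟩).trans ?_
    simp only [hstart, mul_ite, mul_one, mul_zero, Finset.sum_ite_eq', ht, if_true]
  rw [steadyFreq, integral_congr_ae hfreq, integral_const, probReal_univ, one_smul]

end Frequency

end FreqLTL

open FreqLTL in
theorem mainTheorem2_general {S AP : Type*} [MeasurableSpace S] [DiscreteMeasurableSpace S]
    (Δ : S → PMF S) (ν : S → Set AP) (s_in : S) (φ : Formula AP) (p : ℝ) (B : Finset S)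
    (hB : IsBSCC Δ B) :
    ∀ᵐ ω ∂runMeasure Δ s_in, (∃ n, ω n ∈ B) →
      (Sat ν (.freqG p φ) ω ↔ p ≤ ∑ t ∈ B, steadyFreq Δ t * satProb Δ ν t φ) := by
  obtain ⟨μ, _, hμ, hμB⟩ := hB.exists_invariant
  have hsum : ∑ t ∈ B, steadyFreq Δ t * satProb Δ ν t φ =
      ∑ t ∈ B, μ.real {t} * (runMeasure Δ t).real {ω | Sat ν φ ω} :=
    Finset.sum_congr rfl fun t ht => by rw [hB.steadyFreq_eq hμ hμB ht, satProb]
  filter_upwards [hB.ae_freq_indicator_suffix_eq hμ hμB (measurableSet_sat ν φ) s_in] with ω hω hn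
  rw [hsum, ← hω hn]
  rfl

theorem mainTheorem2 {S AP : Type*} [Fintype S] [MeasurableSpace S] [DiscreteMeasurableSpace S]
    (Δ : S → PMF S) (ν : S → Set AP) (s_in : S)
    (φ : FreqLTL.Formula AP) (hφ : φ.IsLTL) (p : ℝ)
    (B : Finset S) (hB : FreqLTL.IsBSCC Δ B) :
    ∀ᵐ ω ∂(FreqLTL.runMeasure Δ s_in), (∃ n, ω n ∈ B) →
      (FreqLTL.Sat ν (FreqLTL.Formula.freqG p φ) ω ↔
        p ≤ ∑ t ∈ B, FreqLTL.steadyFreq Δ t * FreqLTL.satProb Δ ν t φ) :=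
  mainTheorem2_general Δ ν s_in φ p B hB
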